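/- Let $0<\alpha<2$ and $\beta\in\mathbb{R}$. For real $\lambda$ let $$E_{\alpha,\beta}(\lambda)=\sum_{k=0}^{\infty}\frac{\lambda^k}{\Gamma(\beta+\alpha k)}$$ be the generalized Mittag-Leffler function (with $1/\Gamma(z)=0$ for $z=0,-1,-2,\dots$), and, where $E_{\alpha,\beta}(\lambda)\neq 0$, let $$p_k(\lambda,\alpha,\beta)=\frac{1}{E_{\alpha,\beta}(\lambda)}\,\frac{\lambda^k}{\Gamma(\beta+\alpha k)},\qquad k=0,1,2,\dots$$ be the generalized fractional Poisson distribution (for $\beta\le 0$ some of the weights may be negative). Write $\mu_{\alpha,\beta}(\lambda)=\sum_k k\,p_k(\lambda,\alpha,\beta)$ for its mean and $\sigma_{\alpha,\beta}(\lambda)=\sum_k k^2\,p_k(\lambda,\alpha,\beta)-\mu_{\alpha,\beta}(\lambda)^2$ for its variance. Then the series for $E_{\alpha,\beta}(\lambda)$ and for all raw moments $\sum_k k^n p_k(\lambda,\alpha,\beta)$ converge, for all sufficiently large $\lambda$ one has $E_{\alpha,\beta}(\lambda)>0$ and $\sum_k p_k(\lambda,\alpha,\beta)=1$, and as $\lambda\to+\infty$: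 1. $E_{\alpha,\beta}(\lambda)\sim\frac1\alpha\,\lambda^{(1-\beta)/\alpha}\,e^{\lambda^{1/\alpha}}$ (the ratio of the two sides tends to $1$); 2. $\mu_{\alpha,\beta}(\lambda)-\frac{1-\beta+\lambda^{1/\alpha}}{\alpha}\to 0$; 3. $\sigma_{\alpha,\beta}(\lambda)-\frac{\lambda^{1/\alpha}}{\alpha^2}\to 0$. Consequently, asymptotically $\beta$ only shifts the mean and leaves the variance unchanged: as $\lambda\to+\infty$, $\mu_{\alpha,\beta}(\lambda)-\mu_{\alpha,1}(\lambda)\to\frac{1-\beta}{\alpha}$, and $\sigma_{\alpha,\beta}(\lambda)-\sigma_{\alpha,\beta'}(\lambda)\to 0$ for every $\beta'\in\mathbb{R}$. -/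

import Mathlib

open Filter Topology Asymptotics

namespace FracPoisson

/-- The two-parameter Mittag-Leffler function `E_{α,β}(lam) = ∑ lam ^ k / Γ(β + α k)`.
`Real.Gamma` vanishes at its poles `0, -1, -2, …`, and division by zero gives zero, so that
`1 / Γ` is zero there, which is the usual convention (`1 / Γ` is entire). -/
noncomputable def mittagLeffler (α β lam : ℝ) : ℝ :=
  ∑' k : ℕ, lam ^ k / Real.Gamma (β + α * k)

/-- The generalized fractional Poisson distribution `p_k(lam, α, β)`. -/
noncomputable def prob (α β lam : ℝ) (k : ℕ) : ℝ :=
  1 / mittagLeffler α β lam * (lam ^ k / Real.Gamma (β + α * k))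

/-- The `n`-th raw moment `∑ k ^ n p_k(lam, α, β)`. -/
noncomputable def rawMoment (n : ℕ) (α β lam : ℝ) : ℝ :=
  ∑' k : ℕ, (k : ℝ) ^ n * prob α β lam k

/-- The mean: the first raw moment. -/
noncomputable def mean (α β lam : ℝ) : ℝ :=
  rawMoment 1 α β lam

/-- The variance: the second raw moment minus the square of the first. -/
noncomputable def variance (α β lam : ℝ) : ℝ :=
  rawMoment 2 α β lam - rawMoment 1 α β lam ^ 2

end FracPoisson

/-! Put `lam = x ^ α`. Then `x ^ (β - 1) * mittagLeffler α β (x ^ α)` is the series ∑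
x^(β+αk-1)/Γ(β+αk), with Laplace transform z^(-β)/(1 - z^(-α)). For `2 ≤ β` this decays like
|z|^(-2), so the series is an absolutely convergent inversion integral over Re z = 2
(`hasSum_integral_kernel`). Since 0 < α < 2, the only pole with Re z > 0 is z = 1, simple with
residue 1/α. Subtracting 1/α times the transform of e^x - 1 removes it, and moving the line to Re z
= 1/2 gives e^x/α + O(e^(x/2)).

The recursion E_β(λ) = 1/Γ(β) + λ E_(β+α)(λ), with α fixed, carries this down to every real β. The
functional equation of Γ turns a factor k into the shift β ↦ β - 1, so mean and variance are
polynomials in the quotients E_(β-1)/E_β and E_(β-2)/E_β. The relative error is exponentially small,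
hence it survives the cancellation of the x² terms in the variance. -/

namespace FracPoisson

/-! ### Shifting a vertical line of integration -/

open MeasureTheory Complex in
-- Cauchy's theorem on the rectangle of height 2T: the horizontal sides are O(1/(1 + T²)) and vanish
-- as T → ∞.
theorem integral_vertical_eq {f : ℂ → ℂ} {a b C : ℝ} (hab : a ≤ b)
    (hf : DifferentiableOn ℂ f {z | a ≤ z.re ∧ z.re ≤ b})
    (hC : ∀ z : ℂ, a ≤ z.re → z.re ≤ b → ‖f z‖ ≤ C * (1 + z.im ^ 2)⁻¹) :
    ∫ y : ℝ, f (a + y * I) = ∫ y : ℝ, f (b + y * I) := by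
  have hint : ∀ c : ℝ, a ≤ c → c ≤ b → Integrable fun y : ℝ => f (c + y * I) := by
    intro c hac hcb
    refine (integrable_inv_one_add_sq.const_mul C).mono' ?_ (ae_of_all _ fun y => ?_)
    · refine Continuous.aestronglyMeasurable ?_
      refine hf.continuousOn.comp_continuous (by fun_prop) fun y => ?_
      simp [hac, hcb]
    · simpa using hC (c + y * I) (by simpa using hac) (by simpa using hcb)
  have hlim : ∀ c : ℝ, a ≤ c → c ≤ b →
      Tendsto (fun T : ℝ => ∫ y in (-T)..T, f (c + y * I)) atTop (𝓝 (∫ y : ℝ, f (c + y * I))) :=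
    fun c hac hcb => intervalIntegral_tendsto_integral (hint c hac hcb)
      tendsto_neg_atTop_atBot tendsto_id
  have hbd : ∀ T : ℝ, ‖∫ x in a..b, f (x + T * I)‖ ≤ C * (1 + T ^ 2)⁻¹ * |b - a| := by
    intro T
    refine intervalIntegral.norm_integral_le_of_norm_le_const fun x hx => ?_
    rw [Set.uIoc_of_le hab] at hx
    simpa using hC (x + T * I) (by simpa using hx.1.le) (by simpa using hx.2)
  have hz : Tendsto (fun T : ℝ => C * (1 + T ^ 2)⁻¹ * |b - a|) atTop (𝓝 0) := by
    have h1 : Tendsto (fun T : ℝ => (1 + T ^ 2)⁻¹) atTop (𝓝 0) :=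
      tendsto_inv_atTop_zero.comp (tendsto_atTop_add_const_left _ _ (tendsto_pow_atTop two_ne_zero))
    simpa using (h1.const_mul C).mul_const |b - a|
  have htop : Tendsto (fun T : ℝ => ∫ x in a..b, f (x + T * I)) atTop (𝓝 0) :=
    squeeze_zero_norm hbd hz
  have hbot : Tendsto (fun T : ℝ => ∫ x in a..b, f (x + (-T : ℝ) * I)) atTop (𝓝 0) :=
    squeeze_zero_norm (fun T => by simpa using hbd (-T)) hz
  have hrect : ∀ T : ℝ, (∫ x in a..b, f (x + (-T : ℝ) * I)) - (∫ x in a..b, f (x + T * I)) +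
      I • (∫ y in (-T)..T, f (b + y * I)) - I • (∫ y in (-T)..T, f (a + y * I)) = 0 := by
    intro T
    have := Complex.integral_boundary_rect_eq_zero_of_differentiableOn f
      (a + (-T : ℝ) * I) (b + T * I) (hf.mono ?_)
    · simpa using this
    · intro z hz
      have h := hz.1
      simp only [Set.mem_preimage] at h
      rw [Set.uIcc_of_le (by simpa using hab)] at h
      simpa using h
  have hl := (((hbot.sub htop).add ((hlim b hab le_rfl).const_smul I)).sub
    ((hlim a le_rfl hab).const_smul I)).congr hrect
  have h0 := tendsto_nhds_unique hl tendsto_const_nhds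
  rw [sub_zero, zero_add, ← smul_sub, smul_eq_zero] at h0
  exact (sub_eq_zero.mp (h0.resolve_left I_ne_zero)).symm

/-! ### Laplace transform of a power -/

open MeasureTheory in
theorem integrableOn_rpow_mul_exp_neg {s b : ℝ} (hs : -1 < s) (hb : 0 < b) :
    IntegrableOn (fun t : ℝ => t ^ s * Real.exp (-b * t)) (Set.Ioi 0) := by
  simpa only [Real.rpow_one] using integrableOn_rpow_mul_exp_neg_mul_rpow (p := 1) hs one_pos hb

open MeasureTheory Complex in
theorem differentiableAt_integral_rpow_mul_exp {s : ℝ} (hs : 0 < s) {z₀ : ℂ} (hz₀ : 0 < z₀.re) :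
    DifferentiableAt ℂ
      (fun z : ℂ => ∫ t in Set.Ioi (0 : ℝ), ((t ^ (s - 1) : ℝ) : ℂ) * exp (-(z * t))) z₀ := by
  have hmeas : ∀ p : ℝ, Measurable fun t : ℝ => ((t ^ p : ℝ) : ℂ) := fun p => by fun_prop
  have hnorm : ∀ (p : ℝ) (z : ℂ) (t : ℝ), 0 < t →
      ‖((t ^ p : ℝ) : ℂ) * exp (-(z * t))‖ = t ^ p * Real.exp (-z.re * t) := by
    intro p z t ht
    rw [norm_mul, norm_exp, norm_real, Real.norm_of_nonneg (by positivity)]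
    simp
  refine (hasDerivAt_integral_of_dominated_loc_of_deriv_le
    (s := {z : ℂ | z₀.re / 2 < z.re})
    (bound := fun t => t ^ s * Real.exp (-(z₀.re / 2) * t))
    (F := fun z t => ((t ^ (s - 1) : ℝ) : ℂ) * exp (-(z * t)))
    (F' := fun z t => -(((t ^ s : ℝ) : ℂ) * exp (-(z * t)))) ?_ ?_ ?_ ?_ ?_ ?_ ?_).2.differentiableAt
  · exact (isOpen_lt continuous_const continuous_re).mem_nhds (by simp [hz₀])
  · exact .of_forall fun z => ((hmeas _).mul (by fun_prop)).aestronglyMeasurable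
  · refine (integrableOn_rpow_mul_exp_neg (s := s - 1) (by linarith) hz₀).mono'
      ((hmeas _).mul (by fun_prop)).aestronglyMeasurable ?_
    filter_upwards [ae_restrict_mem measurableSet_Ioi] with t ht
    rw [hnorm _ _ _ ht]
  · exact ((hmeas _).mul (by fun_prop)).neg.aestronglyMeasurable
  · filter_upwards [ae_restrict_mem measurableSet_Ioi] with t ht z hz
    have ht' : (0 : ℝ) < t := ht
    rw [norm_neg, hnorm _ _ _ ht]
    have : z₀.re / 2 < z.re := hz
    gcongr
  · exact integrableOn_rpow_mul_exp_neg (by linarith) (half_pos hz₀)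
  · filter_upwards [ae_restrict_mem measurableSet_Ioi] with t ht z hz
    have ht' : (0 : ℝ) < t := ht
    have h1 : HasDerivAt (fun z : ℂ => -(z * t)) (-(1 * t)) z := ((hasDerivAt_id z).mul_const _).neg
    have h2 := h1.cexp.const_mul ((t ^ (s - 1) : ℝ) : ℂ)
    refine h2.congr_deriv ?_
    have h3 : t ^ s = t ^ (s - 1) * t := by
      rw [← Real.rpow_add_one ht'.ne', sub_add_cancel]
    rw [h3]; push_cast; ring

open MeasureTheory Complex in
/-- The Laplace transform of `t ↦ t ^ (s - 1)` on the right half-plane. -/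
theorem integral_rpow_mul_exp_neg {s : ℝ} (hs : 0 < s) {z : ℂ} (hz : 0 < z.re) :
    ∫ t in Set.Ioi (0 : ℝ), ((t ^ (s - 1) : ℝ) : ℂ) * exp (-(z * t)) =
      Real.Gamma s * z ^ (-s : ℂ) := by
  have hU : IsOpen {z : ℂ | 0 < z.re} := isOpen_lt continuous_const continuous_re
  have hf : AnalyticOnNhd ℂ
      (fun z : ℂ => ∫ t in Set.Ioi (0 : ℝ), ((t ^ (s - 1) : ℝ) : ℂ) * exp (-(z * t)))
      {z : ℂ | 0 < z.re} :=
    DifferentiableOn.analyticOnNhd (fun w hw =>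
      (differentiableAt_integral_rpow_mul_exp hs hw).differentiableWithinAt) hU
  have hg : AnalyticOnNhd ℂ (fun z : ℂ => Real.Gamma s * z ^ (-s : ℂ)) {z : ℂ | 0 < z.re} :=
    DifferentiableOn.analyticOnNhd (fun w hw =>
      ((differentiableAt_id.cpow_const (Or.inl hw)).const_mul _).differentiableWithinAt) hU
  -- Identity theorem: both sides are analytic on the half-plane and agree on the positive reals,
  -- which accumulate at 1.
  refine hf.eqOn_of_preconnected_of_frequently_eq hg
    (convex_halfSpace_re_gt 0).isPreconnected (z₀ := 1) (by simp) ?_ hz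
  have hreal : ∀ r : ℝ, 0 < r →
      ∫ t in Set.Ioi (0 : ℝ), ((t ^ (s - 1) : ℝ) : ℂ) * exp (-((r : ℂ) * t)) =
        Real.Gamma s * (r : ℂ) ^ (-s : ℂ) := by
    intro r hr
    have h := Real.integral_rpow_mul_exp_neg_mul_Ioi hs hr
    rw [one_div, Real.inv_rpow hr.le, ← Real.rpow_neg hr.le, mul_comm] at h
    rw [← ofReal_neg, ← ofReal_cpow hr.le, ← ofReal_mul, ← h, ← integral_complex_ofReal]
    refine integral_congr_ae (ae_of_all _ fun t => ?_)
    push_cast; rfl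
  have htend : Tendsto (fun r : ℝ => (r : ℂ)) (𝓝[≠] 1) (𝓝[≠] 1) := by
    refine tendsto_nhdsWithin_of_tendsto_nhds_of_eventually_within _ ?_ ?_
    · exact (continuous_ofReal.tendsto' 1 1 ofReal_one).mono_left nhdsWithin_le_nhds
    · filter_upwards [self_mem_nhdsWithin] with r hr
      simpa using hr
  refine htend.frequently (Eventually.frequently ?_)
  filter_upwards [nhdsWithin_le_nhds (lt_mem_nhds (zero_lt_one' ℝ))] with r hr using hreal r hr

/-! ### Inverse Laplace transform of a power -/

open Complex in
theorem norm_cpow_neg_ofReal (z : ℂ) (s : ℝ) : ‖z ^ (-s : ℂ)‖ = ‖z‖ ^ (-s) := by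
  rw [← norm_cpow_real, ofReal_neg]

open Complex in
theorem norm_cpow_neg_le {z : ℂ} {s : ℝ} (hz : 1 ≤ ‖z‖) (hs : 2 ≤ s) :
    ‖z ^ (-s : ℂ)‖ ≤ 2 * (1 + z.im ^ 2)⁻¹ := by
  calc ‖z ^ (-s : ℂ)‖ ≤ ‖z‖ ^ (-2 : ℝ) := by
        rw [norm_cpow_neg_ofReal]; exact Real.rpow_le_rpow_of_exponent_le hz (by linarith)
    _ = (‖z‖ ^ 2)⁻¹ := by
        rw [Real.rpow_neg (norm_nonneg _)]; norm_cast
    _ ≤ ((1 + z.im ^ 2) / 2)⁻¹ := by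
        refine inv_anti₀ (by positivity) ?_
        have h1 : ‖z‖ ^ 2 = z.re * z.re + z.im * z.im := by
          rw [← normSq_eq_norm_sq, normSq_apply]
        nlinarith [mul_self_nonneg z.re]
    _ = 2 * (1 + z.im ^ 2)⁻¹ := by rw [inv_div, div_eq_mul_inv]

open MeasureTheory Complex in
theorem integrable_cpow_neg_vertical {c s : ℝ} (hc : 1 ≤ c) (hs : 2 ≤ s) :
    Integrable fun y : ℝ => ((c : ℂ) + y * I) ^ (-s : ℂ) := by
  refine (integrable_inv_one_add_sq.const_mul 2).mono' ?_ (ae_of_all _ fun y => ?_)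
  · refine Continuous.aestronglyMeasurable ?_
    refine Continuous.cpow (by fun_prop) continuous_const fun y => Or.inl ?_
    simp; linarith
  · have h1 : 1 ≤ ‖(c : ℂ) + y * I‖ := hc.trans (by simpa using re_le_norm ((c : ℂ) + y * I))
    simpa using norm_cpow_neg_le h1 hs

open MeasureTheory Complex FourierTransform in
/-- The inverse Laplace transform of `z ↦ z ^ (-s)`. -/
theorem integral_exp_mul_cpow_neg_vertical {c s x : ℝ} (hc : 1 ≤ c) (hs : 2 ≤ s) (hx : 0 < x) :
    ∫ y : ℝ, exp (x * (c + y * I)) * ((c : ℂ) + y * I) ^ (-s : ℂ) =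
      2 * Real.pi * (x ^ (s - 1) / Real.Gamma s : ℝ) := by
  have hΓ : Real.Gamma s ≠ 0 := (Real.Gamma_pos_of_pos (by linarith)).ne'
  -- Fourier inversion at x for the damped power: its Fourier transform is the Laplace transform on
  -- Re z = c, integrable because `2 ≤ s`.
  set f : ℝ → ℂ := (Set.Ioi (0 : ℝ)).indicator
    fun t => ((t ^ (s - 1) * Real.exp (-c * t) : ℝ) : ℂ) with hf
  have hfi : Integrable f := by
    rw [hf, integrable_indicator_iff measurableSet_Ioi]
    exact (integrableOn_rpow_mul_exp_neg (by linarith) (by linarith)).ofReal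
  have hF : ∀ w : ℝ, 𝓕 f w = Real.Gamma s * ((c : ℂ) + (2 * Real.pi * w : ℝ) * I) ^ (-s : ℂ) := by
    intro w
    have hre : 0 < ((c : ℂ) + (2 * Real.pi * w : ℝ) * I).re := by simp; linarith
    rw [← integral_rpow_mul_exp_neg (by linarith) hre, Real.fourier_eq', hf,
      ← integral_indicator measurableSet_Ioi]
    refine integral_congr_ae (ae_of_all _ fun t => ?_)
    by_cases ht : t ∈ Set.Ioi (0 : ℝ)
    · simp only [Set.indicator_of_mem ht, smul_eq_mul]
      rw [ofReal_mul (t ^ (s - 1)), mul_left_comm, ofReal_exp, ← exp_add]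
      congr 2
      simp
      ring
    · simp only [Set.indicator_of_notMem ht, smul_zero]
  have hFi : Integrable (𝓕 f) := by
    have := ((integrable_cpow_neg_vertical hc hs).comp_mul_left'
      (Real.two_pi_pos.ne')).const_mul (Real.Gamma s : ℂ)
    refine this.congr (ae_of_all _ fun w => ?_)
    rw [hF]
  have hfc : ContinuousAt f x := by
    have : ContinuousAt (fun t : ℝ => ((t ^ (s - 1) * Real.exp (-c * t) : ℝ) : ℂ)) x := by
      refine continuous_ofReal.continuousAt.comp ?_
      exact (Real.continuousAt_rpow_const _ _ (Or.inl hx.ne')).mul (by fun_prop)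
    refine this.congr ?_
    filter_upwards [lt_mem_nhds hx] with t ht
    simp [hf, ht]
  have hinv := hfi.fourierInv_fourier_eq hFi hfc
  rw [Real.fourierInv_eq'] at hinv
  simp_rw [hF] at hinv
  -- The substitution y = 2πw undoes the normalization of the Fourier transform and produces the
  -- factor 2π.
  have hsub := Measure.integral_comp_mul_left (fun y : ℝ =>
    exp (x * (c + y * I)) * ((c : ℂ) + y * I) ^ (-s : ℂ)) (2 * Real.pi)
  have hpt : ∀ w : ℝ, exp ((2 * Real.pi * inner ℝ w x : ℝ) * I) •
      ((Real.Gamma s : ℂ) * ((c : ℂ) + (2 * Real.pi * w : ℝ) * I) ^ (-s : ℂ)) =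
      (Real.Gamma s * exp (-(c * x))) * (exp (x * (c + (2 * Real.pi * w : ℝ) * I)) *
        ((c : ℂ) + (2 * Real.pi * w : ℝ) * I) ^ (-s : ℂ)) := by
    intro w
    have : exp ((2 * Real.pi * inner ℝ w x : ℝ) * I) =
        exp (-(c * x)) * exp (x * (c + (2 * Real.pi * w : ℝ) * I)) := by
      rw [← exp_add]; congr 1; simp; ring
    rw [this, smul_eq_mul]; ring
  simp_rw [hpt] at hinv
  rw [integral_const_mul, hsub] at hinv
  simp only [hf, Set.indicator_of_mem (Set.mem_Ioi.mpr hx)] at hinv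
  rw [abs_of_pos (by positivity)] at hinv
  have hΓ' : (Real.Gamma s : ℂ) ≠ 0 := by exact_mod_cast hΓ
  have hpi : (Real.pi : ℂ) ≠ 0 := by exact_mod_cast Real.pi_ne_zero
  have hexp : exp (-(c * x) : ℂ) ≠ 0 := exp_ne_zero _
  generalize (∫ y : ℝ, exp (x * (c + y * I)) * ((c : ℂ) + y * I) ^ (-s : ℂ)) = J at hinv ⊢
  rw [real_smul] at hinv
  push_cast at hinv ⊢
  rw [neg_mul] at hinv
  field_simp at hinv ⊢
  linear_combination hinv

/-! ### The kernel and its pole at 1 -/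

/-- The Laplace transform of `x ↦ ∑ k, x ^ (s + α k - 1) / Γ(s + α k)`. -/
noncomputable def kernel (α s : ℝ) (z : ℂ) : ℂ :=
  z ^ (-s : ℂ) / (1 - z ^ (-α : ℂ))

open Complex in
-- In the right half-plane |α arg z| < π, so -α log z can equal 2πin only for n = 0.
theorem eq_one_of_cpow_neg_eq_one {α : ℝ} (hα₀ : 0 < α) (hα₂ : α < 2) {z : ℂ} (hz : 0 < z.re)
    (h : z ^ (-α : ℂ) = 1) : z = 1 := by
  have hz0 : z ≠ 0 := fun h0 => by simp [h0] at hz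
  rw [cpow_def_of_ne_zero hz0, exp_eq_one_iff] at h
  obtain ⟨n, hn⟩ := h
  have hre := congrArg re hn
  have him := congrArg im hn
  simp at hre him
  have harg : |z.arg| < Real.pi / 2 := abs_arg_lt_pi_div_two_iff.mpr (Or.inl hz)
  have hn0 : n = 0 := by
    have h1 : |z.arg * α| < Real.pi := by
      rw [abs_mul, abs_of_pos hα₀]
      nlinarith [abs_nonneg z.arg, Real.pi_pos]
    have h2 : |(n : ℝ)| < 1 := by
      have h3 : |(n : ℝ)| * (2 * Real.pi) < Real.pi := by
        rw [← abs_of_pos Real.two_pi_pos, ← abs_mul, ← him, abs_neg]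
        rwa [log_im]
      nlinarith [Real.pi_pos, abs_nonneg (n : ℝ)]
    exact Int.abs_lt_one_iff.mp (by exact_mod_cast h2)
  rw [hn0, Int.cast_zero, zero_mul, mul_eq_zero] at hn
  have hlog : log z = 0 := hn.resolve_right (by simpa using hα₀.ne')
  rw [← exp_log hz0, hlog, exp_zero]

open Complex in
theorem differentiableOn_cpow_const_re_pos (c : ℂ) :
    DifferentiableOn ℂ (fun z : ℂ => z ^ c) {z | 0 < z.re} := fun _ hz =>
  (differentiableAt_id.cpow_const (Or.inl hz)).differentiableWithinAt

open Complex in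
/-- The kernel has a simple pole at `1` with residue `1 / α`, and no other pole in the right
half-plane. -/
theorem exists_kernel_eq_div {α : ℝ} (hα₀ : 0 < α) (hα₂ : α < 2) (s : ℝ) :
    ∃ N : ℂ → ℂ, DifferentiableOn ℂ N {z | 0 < z.re} ∧ N 1 = 1 / α ∧
      ∀ z : ℂ, 0 < z.re → z ≠ 1 → kernel α s z = N z / (z - 1) := by
  have hU : {z : ℂ | 0 < z.re} ∈ 𝓝 (1 : ℂ) :=
    (isOpen_lt continuous_const continuous_re).mem_nhds (by simp)
  set g : ℂ → ℂ := fun z => 1 - z ^ (-α : ℂ) with hg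
  have hgd : DifferentiableOn ℂ g {z | 0 < z.re} :=
    (differentiableOn_cpow_const_re_pos _).const_sub 1
  have hq1 : dslope g 1 1 = α := by
    rw [dslope_same]
    have h1 : HasDerivAt (fun z : ℂ => z ^ (-α : ℂ)) (-α * (1 : ℂ) ^ (-α - 1 : ℂ) * 1) 1 :=
      (hasDerivAt_id (1 : ℂ)).cpow_const (Or.inl (by simp))
    rw [(h1.const_sub 1).deriv]
    simp
  have hqz : ∀ z : ℂ, z ≠ 1 → dslope g 1 z = (1 - z ^ (-α : ℂ)) / (z - 1) := by
    intro z hz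
    rw [dslope_of_ne _ hz, slope_def_field]
    simp [hg]
  have hα : (α : ℂ) ≠ 0 := by exact_mod_cast hα₀.ne'
  -- `dslope g 1` is the denominator with its simple zero at 1 divided out; it takes the value α
  -- there and vanishes nowhere on the half-plane.
  refine ⟨fun z => z ^ (-s : ℂ) / dslope g 1 z, ?_, ?_, ?_⟩
  · refine (differentiableOn_cpow_const_re_pos _).div
      ((differentiableOn_dslope hU).mpr hgd) fun z hz => ?_
    by_cases h1 : z = 1
    · rw [h1, hq1]; exact hα
    · rw [hqz z h1]
      exact div_ne_zero (sub_ne_zero.mpr fun h =>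
        h1 (eq_one_of_cpow_neg_eq_one hα₀ hα₂ hz h.symm)) (sub_ne_zero.mpr h1)
  · simp only [hq1, one_cpow]
  · intro z _ h1
    have h1' := sub_ne_zero.mpr h1
    simp only [hqz z h1]
    rw [kernel, div_div_eq_mul_div, mul_div_right_comm, mul_div_cancel_right₀ _ h1']

open Complex in
theorem norm_kernel_le {α s : ℝ} (hs : 2 ≤ s) {z : ℂ} (hz : 1 ≤ ‖z‖) (h : ‖z‖ ^ (-α) ≤ 1 / 2) :
    ‖kernel α s z‖ ≤ 4 * (1 + z.im ^ 2)⁻¹ := by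
  have h1 : 1 / 2 ≤ ‖1 - z ^ (-α : ℂ)‖ := by
    have h2 := norm_sub_norm_le 1 (z ^ (-α : ℂ))
    rw [norm_one, norm_cpow_neg_ofReal] at h2
    linarith
  rw [kernel, norm_div, div_le_iff₀ (by linarith)]
  have h3 := norm_cpow_neg_le hz hs
  have h4 : 0 ≤ (1 + z.im ^ 2)⁻¹ := by positivity
  nlinarith

open Complex in
-- `kernel 1 2 z` is 1/(z(z - 1)), the transform of e^x - 1, with residue 1 at 1. The combination
-- has residue 0 there, so it extends holomorphically.
theorem exists_kernel_sub_kernel {α s : ℝ} (hα₀ : 0 < α) (hα₂ : α < 2) (hs : 2 ≤ s) :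
    ∃ (Φ : ℂ → ℂ) (C : ℝ), DifferentiableOn ℂ Φ {z | 0 < z.re} ∧
      (∀ z : ℂ, 1 / 2 ≤ z.re → z.re ≤ 2 → ‖Φ z‖ ≤ C * (1 + z.im ^ 2)⁻¹) ∧
      ∀ z : ℂ, 0 < z.re → z ≠ 1 → Φ z = kernel α s z - 1 / α * kernel 1 2 z := by
  obtain ⟨N, hNd, hN1, hN⟩ := exists_kernel_eq_div hα₀ hα₂ s
  obtain ⟨M, hMd, hM1, hM⟩ := exists_kernel_eq_div one_pos one_lt_two 2
  have hU : {z : ℂ | 0 < z.re} ∈ 𝓝 (1 : ℂ) :=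
    (isOpen_lt continuous_const continuous_re).mem_nhds (by simp)
  set P : ℂ → ℂ := fun z => N z - 1 / α * M z with hP
  have hΦd : DifferentiableOn ℂ (dslope P 1) {z | 0 < z.re} :=
    (differentiableOn_dslope hU).mpr (hNd.sub (hMd.const_mul _))
  have hP1 : P 1 = 0 := by simp [hP, hN1, hM1]
  have hΦ : ∀ z : ℂ, 0 < z.re → z ≠ 1 → dslope P 1 z = kernel α s z - 1 / α * kernel 1 2 z := by
    intro z hz h1
    rw [dslope_of_ne _ h1, slope_def_field, hP1, sub_zero, hN z hz h1, hM z hz h1]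
    simp only [hP]
    ring
  -- Outside the disc of radius R both denominators have modulus at least 1/2; inside it compactness
  -- gives the bound.
  obtain ⟨R, hR2, hRα, hR1⟩ : ∃ R : ℝ, 2 ≤ R ∧ (∀ r, R ≤ r → r ^ (-α) ≤ 1 / 2) ∧
      ∀ r, R ≤ r → r ^ (-1 : ℝ) ≤ 1 / 2 := by
    have h1 := (tendsto_rpow_neg_atTop hα₀).eventually (ge_mem_nhds (one_half_pos (α := ℝ)))
    have h2 := (tendsto_rpow_neg_atTop one_pos).eventually (ge_mem_nhds (one_half_pos (α := ℝ)))
    obtain ⟨R₁, h1⟩ := eventually_atTop.mp h1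
    obtain ⟨R₂, h2⟩ := eventually_atTop.mp h2
    exact ⟨max 2 (max R₁ R₂), le_max_left _ _,
      fun r hr => h1 r ((le_max_of_le_right (le_max_left _ _)).trans hr),
      fun r hr => h2 r ((le_max_of_le_right (le_max_right _ _)).trans hr)⟩
  have hK : IsCompact ({z : ℂ | 1 / 2 ≤ z.re} ∩ Metric.closedBall 0 R) :=
    (isCompact_closedBall _ _).inter_left (isClosed_le continuous_const continuous_re)
  obtain ⟨B, hB⟩ := hK.exists_bound_of_continuousOn
    (hΦd.continuousOn.mono fun z hz =>
      lt_of_lt_of_le (one_half_pos (α := ℝ)) hz.1)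
  refine ⟨dslope P 1, max (B * (1 + R ^ 2)) (4 + 1 / α * 4), hΦd, fun z hz _ => ?_, hΦ⟩
  have hpos : 0 < (1 + z.im ^ 2)⁻¹ := by positivity
  rcases le_total ‖z‖ R with hzR | hzR
  · have h1 := hB z ⟨hz, by simpa using hzR⟩
    have h2 : z.im ^ 2 ≤ R ^ 2 := by
      rw [← sq_abs]; exact pow_le_pow_left₀ (abs_nonneg _) ((abs_im_le_norm z).trans hzR) 2
    refine le_trans ?_ (mul_le_mul_of_nonneg_right (le_max_left _ _) hpos.le)
    rw [← div_eq_mul_inv, le_div_iff₀ (by positivity)]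
    have hB0 : 0 ≤ B := (norm_nonneg _).trans h1
    gcongr
  · have hz1 : z ≠ 1 := by rintro rfl; simp at hzR; linarith
    rw [hΦ z (by linarith) hz1]
    refine le_trans ?_ (mul_le_mul_of_nonneg_right (le_max_right _ _) hpos.le)
    refine (norm_sub_le _ _).trans ?_
    have h1 := norm_kernel_le hs (z := z) (α := α) (by linarith) (hRα _ hzR)
    have h2 := norm_kernel_le (le_refl 2) (z := z) (α := 1) (by linarith) (hR1 _ hzR)
    have h3 : ‖(1 / α : ℂ)‖ = 1 / α := by
      rw [← ofReal_one, ← ofReal_div, norm_real, Real.norm_of_nonneg (by positivity)]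
    rw [norm_mul, h3, add_mul, mul_assoc]
    gcongr

/-! ### The series as an integral over Re z = 2 -/

open Complex in
theorem norm_two_add_mul_I_ge (y : ℝ) : 2 ≤ ‖(2 : ℝ) + y * I‖ := by
  simpa using re_le_norm ((2 : ℝ) + y * I)

open Complex in
theorem norm_cpow_neg_vertical_le {α : ℝ} (hα : 0 < α) (y : ℝ) :
    ‖((2 : ℝ) + y * I : ℂ) ^ (-α : ℂ)‖ ≤ (2 : ℝ) ^ (-α) := by
  rw [norm_cpow_neg_ofReal]
  exact Real.rpow_le_rpow_of_nonpos two_pos (norm_two_add_mul_I_ge y) (by linarith)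

theorem two_rpow_neg_lt_one {α : ℝ} (hα : 0 < α) : (2 : ℝ) ^ (-α) < 1 :=
  Real.rpow_lt_one_of_one_lt_of_neg one_lt_two (by linarith)

open MeasureTheory Complex in
theorem integrable_exp_mul_cpow_neg {s x : ℝ} (hs : 2 ≤ s) :
    Integrable fun y : ℝ => exp (x * ((2 : ℝ) + y * I)) * ((2 : ℝ) + y * I : ℂ) ^ (-s : ℂ) := by
  refine (integrable_cpow_neg_vertical one_le_two hs).bdd_mul (c := Real.exp (x * 2))
    (by fun_prop : Continuous _).aestronglyMeasurable (ae_of_all _ fun y => ?_)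
  rw [norm_exp]; simp

open MeasureTheory Complex in
theorem integrable_exp_mul_kernel {α s x : ℝ} (hα : 0 < α) (hs : 2 ≤ s) :
    Integrable fun y : ℝ => exp (x * ((2 : ℝ) + y * I)) * kernel α s ((2 : ℝ) + y * I) := by
  have h0 := two_rpow_neg_lt_one hα
  have hne : ∀ y : ℝ, 1 - (2 : ℝ) ^ (-α) ≤ ‖1 - ((2 : ℝ) + y * I : ℂ) ^ (-α : ℂ)‖ := fun y => by
    have h1 := norm_sub_norm_le 1 (((2 : ℝ) + y * I : ℂ) ^ (-α : ℂ))
    rw [norm_one] at h1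
    linarith [norm_cpow_neg_vertical_le hα y]
  have hcont : Continuous fun y : ℝ => (1 - ((2 : ℝ) + y * I : ℂ) ^ (-α : ℂ))⁻¹ := by
    refine Continuous.inv₀ (continuous_const.sub (Continuous.cpow (by fun_prop) continuous_const
      fun y => Or.inl (by simp))) fun y h => ?_
    have := hne y
    rw [h, norm_zero] at this
    linarith
  have := (integrable_exp_mul_cpow_neg (x := x) hs).bdd_mul (c := (1 - (2 : ℝ) ^ (-α))⁻¹)
    hcont.aestronglyMeasurable (ae_of_all _ fun y => by
      rw [norm_inv]; exact inv_anti₀ (by linarith) (hne y))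
  refine this.congr (ae_of_all _ fun y => ?_)
  simp only [kernel]
  ring

open MeasureTheory Complex in
-- Expand 1/(1 - z^(-α)) as a geometric series, of ratio at most 2^(-α) < 1 in modulus on Re z = 2,
-- and invert term by term.
theorem hasSum_integral_kernel {α s x : ℝ} (hα : 0 < α) (hs : 2 ≤ s) (hx : 0 < x) :
    HasSum (fun k : ℕ => (2 * Real.pi : ℂ) *
        (x ^ (s + α * k - 1) / Real.Gamma (s + α * k) : ℝ))
      (∫ y : ℝ, exp (x * ((2 : ℝ) + y * I)) * kernel α s ((2 : ℝ) + y * I)) := by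
  set F : ℕ → ℝ → ℂ := fun k y =>
    exp (x * ((2 : ℝ) + y * I)) * ((2 : ℝ) + y * I : ℂ) ^ (-(s + α * k : ℝ) : ℂ) with hF
  have hsk : ∀ k : ℕ, 2 ≤ s + α * k := fun k => by
    have : 0 ≤ α * k := by positivity
    linarith
  have hFi : ∀ k, Integrable (F k) := fun k => integrable_exp_mul_cpow_neg (hsk k)
  have hFk : ∀ k y, F k y = F 0 y * (((2 : ℝ) + y * I : ℂ) ^ (-α : ℂ)) ^ k := by
    intro k y
    have h0 : ((2 : ℝ) + y * I : ℂ) ≠ 0 := fun h => by simpa using congrArg re h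
    simp only [hF]
    rw [mul_assoc, ← cpow_mul_nat, ← cpow_add _ _ h0]
    congr 2
    push_cast
    ring
  have h2 := two_rpow_neg_lt_one hα
  have h2' : (0 : ℝ) ≤ 2 ^ (-α) := by positivity
  have hsum : Summable fun k => ∫ y, ‖F k y‖ := by
    refine Summable.of_nonneg_of_le (fun k => integral_nonneg fun y => norm_nonneg _) (fun k => ?_)
      ((summable_geometric_of_lt_one h2' h2).mul_left (∫ y, ‖F 0 y‖))
    rw [← integral_mul_const]
    refine integral_mono (hFi k).norm ((hFi 0).norm.mul_const _) fun y => ?_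
    simp only
    rw [hFk, norm_mul, norm_pow]
    gcongr
    exact norm_cpow_neg_vertical_le hα y
  have h := hasSum_integral_of_summable_integral_norm hFi hsum
  have hL : ∀ k, ∫ y, F k y = (2 * Real.pi : ℂ) *
      (x ^ (s + α * k - 1) / Real.Gamma (s + α * k) : ℝ) :=
    fun k => integral_exp_mul_cpow_neg_vertical one_le_two (hsk k) hx
  have hR : ∀ y : ℝ, ∑' k, F k y =
      exp (x * ((2 : ℝ) + y * I)) * kernel α s ((2 : ℝ) + y * I) := by
    intro y
    rw [tsum_congr fun k => hFk k y, tsum_mul_left, tsum_geometric_of_norm_lt_one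
      ((norm_cpow_neg_vertical_le hα y).trans_lt h2)]
    simp only [hF, kernel, Nat.cast_zero, mul_zero, add_zero]
    ring
  simp_rw [hL, hR] at h
  exact h

theorem summable_rpow_div_Gamma {α s x : ℝ} (hα : 0 < α) (hs : 2 ≤ s) (hx : 0 < x) :
    Summable fun k : ℕ => x ^ (s + α * k - 1) / Real.Gamma (s + α * k) := by
  have h := (hasSum_integral_kernel hα hs hx).summable
  have hpi : (2 * Real.pi : ℂ) ≠ 0 := by exact_mod_cast Real.two_pi_pos.ne'
  exact Complex.summable_ofReal.mp ((summable_mul_left_iff hpi).mp h)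

theorem tsum_rpow_div_Gamma {α s x : ℝ} (hα : 0 < α) (hs : 2 ≤ s) (hx : 0 < x) :
    (2 * Real.pi : ℂ) * (∑' k : ℕ, x ^ (s + α * k - 1) / Real.Gamma (s + α * k) : ℝ) =
      ∫ y : ℝ, Complex.exp (x * ((2 : ℝ) + y * Complex.I)) *
        kernel α s ((2 : ℝ) + y * Complex.I) := by
  rw [← (hasSum_integral_kernel hα hs hx).tsum_eq, tsum_mul_left, Complex.ofReal_tsum]

theorem tsum_rpow_div_Gamma_one_two (x : ℝ) :
    ∑' k : ℕ, x ^ ((2 : ℝ) + 1 * k - 1) / Real.Gamma (2 + 1 * k) = Real.exp x - 1 := by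
  have h := NormedSpace.expSeries_div_hasSum_exp x
  rw [← Real.exp_eq_exp_ℝ] at h
  have h1 := ((hasSum_nat_add_iff' 1).mpr h).tsum_eq
  simp only [Finset.range_one, Finset.sum_singleton, pow_zero, Nat.factorial_zero, Nat.cast_one,
    div_one] at h1
  rw [← h1]
  refine tsum_congr fun k => ?_
  have e1 : (2 : ℝ) + 1 * k - 1 = ((k + 1 : ℕ) : ℝ) := by push_cast; ring
  have e2 : (2 : ℝ) + 1 * k = ((k + 1 : ℕ) : ℝ) + 1 := by push_cast; ring
  rw [e1, e2, Real.Gamma_nat_eq_factorial, Real.rpow_natCast]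

/-! ### Exponential asymptotics for `2 ≤ s` -/

open MeasureTheory Complex in
theorem exists_abs_tsum_sub_exp_le_of_two_le {α s : ℝ} (hα₀ : 0 < α) (hα₂ : α < 2) (hs : 2 ≤ s) :
    ∃ C : ℝ, ∀ x : ℝ, 0 < x →
      |∑' k : ℕ, x ^ (s + α * k - 1) / Real.Gamma (s + α * k) - Real.exp x / α| ≤
        C * Real.exp (x / 2) := by
  obtain ⟨Φ, C, hΦd, hΦC, hΦ⟩ := exists_kernel_sub_kernel hα₀ hα₂ hs
  -- `C / 2` is Cπ/(2π), from integrating C/(1 + y²) on Re z = 1/2; `1 / α` absorbs the constant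
  -- left by e^x - 1.
  refine ⟨C / 2 + 1 / α, fun x hx => ?_⟩
  set S := ∑' k : ℕ, x ^ (s + α * k - 1) / Real.Gamma (s + α * k) with hS
  have hC0 : 0 ≤ C := by
    have := (norm_nonneg _).trans (hΦC 1 (by norm_num) (by norm_num))
    simpa using this
  have hbound : ∀ z : ℂ, 1 / 2 ≤ z.re → z.re ≤ 2 →
      ‖exp (x * z) * Φ z‖ ≤ Real.exp (x * z.re) * C * (1 + z.im ^ 2)⁻¹ := by
    intro z h1 h2
    rw [norm_mul, norm_exp, mul_assoc]
    have : ((x : ℂ) * z).re = x * z.re := by simp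
    rw [this]
    gcongr
    exact hΦC z h1 h2
  have hshift := integral_vertical_eq (f := fun z => exp (x * z) * Φ z) (a := 1 / 2) (b := 2)
    (C := Real.exp (x * 2) * C) (by norm_num) ?_ ?_
  rotate_left
  · refine (by fun_prop : Differentiable ℂ fun z : ℂ => exp (x * z)).differentiableOn.mul
      (hΦd.mono fun z hz => lt_of_lt_of_le (by norm_num) hz.1)
  · intro z h1 h2
    refine (hbound z h1 h2).trans ?_
    gcongr
  have hval : ∫ y : ℝ, exp (x * ((2 : ℝ) + y * I)) * Φ ((2 : ℝ) + y * I) =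
      ((2 * Real.pi * (S - 1 / α * (Real.exp x - 1)) : ℝ) : ℂ) := by
    have h1 := tsum_rpow_div_Gamma hα₀ hs hx
    have h2 := tsum_rpow_div_Gamma one_pos (le_refl 2) hx
    rw [← hS] at h1
    rw [tsum_rpow_div_Gamma_one_two] at h2
    push_cast at h1 h2 ⊢
    rw [mul_sub, mul_left_comm, h1, h2, ← integral_const_mul, ← integral_sub]
    · refine integral_congr_ae (ae_of_all _ fun y => ?_)
      have hΦy := hΦ ((2 : ℝ) + y * I) (by simp) (fun h => by simpa using congrArg re h)
      push_cast at hΦy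
      simp only [hΦy]
      ring
    · simpa using integrable_exp_mul_kernel (x := x) hα₀ hs
    · simpa using (integrable_exp_mul_kernel (x := x) one_pos (le_refl 2)).const_mul (1 / α : ℂ)
  have hnorm : ‖∫ y : ℝ, exp (x * ((1 / 2 : ℝ) + y * I)) * Φ ((1 / 2 : ℝ) + y * I)‖ ≤
      Real.exp (x / 2) * C * Real.pi := by
    have h1 := norm_integral_le_of_norm_le (integrable_inv_one_add_sq.const_mul
      (Real.exp (x * (1 / 2)) * C)) (ae_of_all volume fun y : ℝ =>
        (hbound ((1 / 2 : ℝ) + y * I) (by simp) (by simp; norm_num)).trans_eq (by simp))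
    rw [integral_const_mul, integral_univ_inv_one_add_sq] at h1
    refine h1.trans_eq ?_
    ring_nf
  rw [hshift, hval, norm_real, Real.norm_eq_abs, abs_mul, abs_of_pos Real.two_pi_pos] at hnorm
  have h3 : |S - 1 / α * (Real.exp x - 1)| ≤ C / 2 * Real.exp (x / 2) := by
    have := Real.pi_pos
    nlinarith
  have h4 : 1 ≤ Real.exp (x / 2) := Real.one_le_exp (by positivity)
  have h5 : S - Real.exp x / α = (S - 1 / α * (Real.exp x - 1)) - 1 / α := by ring
  have h6 : |(1 / α : ℝ)| = 1 / α := abs_of_pos (by positivity)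
  have h7 : 1 / α ≤ 1 / α * Real.exp (x / 2) := le_mul_of_one_le_right (by positivity) h4
  calc |S - Real.exp x / α| ≤ |S - 1 / α * (Real.exp x - 1)| + |1 / α| := by
        rw [h5]; exact abs_sub _ _
    _ ≤ (C / 2 + 1 / α) * Real.exp (x / 2) := by rw [h6]; linarith

/-! ### Summability and moments through shifts of β -/

/-- The functional equation for the reciprocal of Γ has no exceptional points: at the poles the
convention 1/Γ = 0 keeps it true. -/
theorem one_div_Gamma_sub_one (u : ℝ) : 1 / Real.Gamma (u - 1) = (u - 1) / Real.Gamma u := by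
  by_cases h : u - 1 = 0
  · simp [h]
  · have h1 := Real.Gamma_add_one h
    rw [sub_add_cancel] at h1
    rw [h1, div_mul_eq_div_div, div_self h]

/-- Write αk = (β + αk - 1) + (1 - β); the first summand lowers the argument of Γ by one. -/
theorem natCast_mul_term {α : ℝ} (hα : α ≠ 0) (β lam : ℝ) (k : ℕ) :
    (k : ℝ) * (lam ^ k / Real.Gamma (β + α * k)) =
      (lam ^ k / Real.Gamma (β - 1 + α * k) + (1 - β) * (lam ^ k / Real.Gamma (β + α * k))) / α := by
  have h := one_div_Gamma_sub_one (β + α * k)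
  have e : β - 1 + α * k = β + α * k - 1 := by ring
  rw [e, eq_div_iff hα, div_eq_mul_one_div _ (Real.Gamma (β + α * k - 1)), h]
  ring

theorem summable_term_of_two_le {α : ℝ} (hα : 0 < α) {s : ℝ} (hs : 2 ≤ s) (lam : ℝ) :
    Summable fun k : ℕ => lam ^ k / Real.Gamma (s + α * k) := by
  -- The maximum with 1 keeps M positive when `lam = 0`; x = M^(1/α) then gives a dominating series.
  set M := max |lam| 1 with hM
  have hM0 : 0 < M := lt_max_of_lt_right one_pos
  have hx : 0 < M ^ α⁻¹ := Real.rpow_pos_of_pos hM0 _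
  refine ((summable_rpow_div_Gamma hα hs hx).mul_left ((M ^ α⁻¹) ^ (1 - s))).of_norm_bounded
    fun k => ?_
  have hΓ : 0 < Real.Gamma (s + α * k) := Real.Gamma_pos_of_pos (by positivity)
  rw [← mul_div_assoc, ← Real.rpow_add hx, norm_div, norm_pow, Real.norm_eq_abs,
    Real.norm_of_nonneg hΓ.le]
  have e : 1 - s + (s + α * k - 1) = α * k := by ring
  rw [e, Real.rpow_mul hx.le, Real.rpow_inv_rpow hM0.le hα.ne', Real.rpow_natCast]
  gcongr
  exact le_max_left _ _

theorem exists_two_le_add_natCast_mul {α : ℝ} (hα : 0 < α) (β : ℝ) : ∃ n : ℕ, 2 ≤ β + n * α := by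
  obtain ⟨n, hn⟩ := exists_nat_ge ((2 - β) / α)
  exact ⟨n, by rw [div_le_iff₀ hα] at hn; linarith⟩

/-- Induction along the shifts `β ↦ β - α`, started on `2 ≤ β`. -/
theorem induction_sub {α : ℝ} (hα : 0 < α) {P : ℝ → Prop} (h2 : ∀ β, 2 ≤ β → P β)
    (hstep : ∀ β, P (β + α) → P β) (β : ℝ) : P β := by
  obtain ⟨n, hn⟩ := exists_two_le_add_natCast_mul hα β
  induction n generalizing β with
  | zero => exact h2 β (by simpa using hn)
  | succ n ih => exact hstep β (ih (β + α) (by push_cast at hn; linarith))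

theorem term_succ (α β lam : ℝ) (k : ℕ) :
    lam ^ (k + 1) / Real.Gamma (β + α * (k + 1 : ℕ)) =
      lam * (lam ^ k / Real.Gamma (β + α + α * k)) := by
  have e : β + α * (k + 1 : ℕ) = β + α + α * k := by push_cast; ring
  rw [e]; ring

theorem summable_term {α : ℝ} (hα : 0 < α) (β lam : ℝ) :
    Summable fun k : ℕ => lam ^ k / Real.Gamma (β + α * k) := by
  refine induction_sub hα (P := fun β => Summable fun k : ℕ => lam ^ k / Real.Gamma (β + α * k))
    (fun s hs => summable_term_of_two_le hα hs lam) (fun β h => ?_) β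
  rw [← summable_nat_add_iff 1]
  simp_rw [term_succ]
  exact h.mul_left lam

theorem summable_pow_mul_term {α : ℝ} (hα : 0 < α) (n : ℕ) (β lam : ℝ) :
    Summable fun k : ℕ => (k : ℝ) ^ n * (lam ^ k / Real.Gamma (β + α * k)) := by
  induction n generalizing β with
  | zero => simpa using summable_term hα β lam
  | succ n ih =>
    refine (((ih (β - 1)).add ((ih β).mul_left (1 - β))).div_const α).congr fun k => ?_
    rw [pow_succ, mul_assoc, natCast_mul_term hα.ne']
    ring

theorem tsum_pow_succ_mul_term {α : ℝ} (hα : 0 < α) (n : ℕ) (β lam : ℝ) :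
    ∑' k : ℕ, (k : ℝ) ^ (n + 1) * (lam ^ k / Real.Gamma (β + α * k)) =
      (∑' k : ℕ, (k : ℝ) ^ n * (lam ^ k / Real.Gamma (β - 1 + α * k)) +
        (1 - β) * ∑' k : ℕ, (k : ℝ) ^ n * (lam ^ k / Real.Gamma (β + α * k))) / α := by
  rw [← tsum_mul_left, ← (summable_pow_mul_term hα n (β - 1) lam).tsum_add
    ((summable_pow_mul_term hα n β lam).mul_left (1 - β)), ← tsum_div_const]
  refine tsum_congr fun k => ?_
  rw [pow_succ, mul_assoc, natCast_mul_term hα.ne']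
  ring

theorem rawMoment_eq (n : ℕ) (α β lam : ℝ) :
    rawMoment n α β lam =
      (∑' k : ℕ, (k : ℝ) ^ n * (lam ^ k / Real.Gamma (β + α * k))) / mittagLeffler α β lam := by
  rw [rawMoment, ← tsum_div_const]
  refine tsum_congr fun k => ?_
  rw [prob]; ring

theorem tsum_natCast_mul_term {α : ℝ} (hα : 0 < α) (β lam : ℝ) :
    ∑' k : ℕ, (k : ℝ) ^ 1 * (lam ^ k / Real.Gamma (β + α * k)) =
      (mittagLeffler α (β - 1) lam + (1 - β) * mittagLeffler α β lam) / α := by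
  have h := tsum_pow_succ_mul_term hα 0 β lam
  simpa only [zero_add, pow_zero, one_mul, mittagLeffler] using h

theorem mean_eq {α β lam : ℝ} (hα : 0 < α) (hE : mittagLeffler α β lam ≠ 0) :
    mean α β lam = (mittagLeffler α (β - 1) lam / mittagLeffler α β lam + (1 - β)) / α := by
  rw [mean, rawMoment_eq, tsum_natCast_mul_term hα]
  field_simp

/-- Subtracting the squared mean cancels every explicit factor 1 - β, so β enters only through the
quotients. -/
theorem variance_eq {α β lam : ℝ} (hα : 0 < α) (hE : mittagLeffler α β lam ≠ 0) :
    variance α β lam = (mittagLeffler α (β - 2) lam / mittagLeffler α β lam +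
      mittagLeffler α (β - 1) lam / mittagLeffler α β lam -
      (mittagLeffler α (β - 1) lam / mittagLeffler α β lam) ^ 2) / α ^ 2 := by
  have e : β - 1 - 1 = β - 2 := by ring
  rw [variance, rawMoment_eq, rawMoment_eq, tsum_natCast_mul_term hα,
    tsum_pow_succ_mul_term hα 1 β lam, tsum_natCast_mul_term hα, tsum_natCast_mul_term hα, e]
  field_simp
  ring

/-! ### Asymptotics for every real β -/

theorem mittagLeffler_eq_add {α : ℝ} (hα : 0 < α) (β lam : ℝ) :
    mittagLeffler α β lam = 1 / Real.Gamma β + lam * mittagLeffler α (β + α) lam := by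
  rw [mittagLeffler, (summable_term hα β lam).tsum_eq_zero_add, mittagLeffler, ← tsum_mul_left]
  simp_rw [term_succ]
  simp

/-- Descending from β + α to β only adds x^(β-1)/Γ(β), which is O(e^(x/2)); the main term e^x/α is
unchanged. -/
theorem rpow_mul_mittagLeffler_sub_isBigO {α : ℝ} (hα₀ : 0 < α) (hα₂ : α < 2) (β : ℝ) :
    (fun x : ℝ => x ^ (β - 1) * mittagLeffler α β (x ^ α) - Real.exp x / α) =O[atTop]
      fun x => Real.exp (x / 2) := by
  refine induction_sub hα₀ (P := fun β => (fun x : ℝ => x ^ (β - 1) * mittagLeffler α β (x ^ α) -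
    Real.exp x / α) =O[atTop] fun x => Real.exp (x / 2)) (fun s hs => ?_) (fun β h => ?_) β
  · obtain ⟨C, hC⟩ := exists_abs_tsum_sub_exp_le_of_two_le hα₀ hα₂ hs
    refine IsBigO.of_bound C ?_
    filter_upwards [eventually_gt_atTop 0] with x hx
    rw [Real.norm_eq_abs, Real.norm_of_nonneg (Real.exp_pos _).le]
    refine le_of_eq_of_le ?_ (hC x hx)
    rw [mittagLeffler, ← tsum_mul_left]
    congr 2
    refine tsum_congr fun k => ?_
    rw [← mul_div_assoc, ← Real.rpow_natCast, ← Real.rpow_mul hx.le, ← Real.rpow_add hx]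
    congr 2
    ring
  · have h1 : (fun x : ℝ => 1 / Real.Gamma β * x ^ (β - 1)) =O[atTop]
        fun x => Real.exp (x / 2) := by
      have := (isLittleO_rpow_exp_pos_mul_atTop (β - 1) (one_half_pos (α := ℝ))).isBigO
      refine (this.const_mul_left _).congr_right fun x => ?_
      ring_nf
    refine (h1.add h).congr' ?_ EventuallyEq.rfl
    filter_upwards [eventually_gt_atTop 0] with x hx
    rw [mittagLeffler_eq_add hα₀ β, show β + α - 1 = β - 1 + α by ring, Real.rpow_add hx]
    ring

/-- `mittagLeffler α β (x ^ α)` divided by its leading asymptotics. -/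
noncomputable def ratio (α β x : ℝ) : ℝ :=
  α * Real.exp (-x) * x ^ (β - 1) * mittagLeffler α β (x ^ α)

/-- The ratio differs from 1 by O(e^(-x/2)), which beats every power; n = 2 is what the variance
needs. -/
theorem tendsto_pow_mul_ratio_sub_one {α : ℝ} (hα₀ : 0 < α) (hα₂ : α < 2) (β : ℝ) (n : ℕ) :
    Tendsto (fun x => x ^ n * (ratio α β x - 1)) atTop (𝓝 0) := by
  have h := (isBigO_refl (fun x : ℝ => x ^ n * (α * Real.exp (-x))) atTop).mul
    (rpow_mul_mittagLeffler_sub_isBigO hα₀ hα₂ β)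
  have h0 : Tendsto (fun x : ℝ => x ^ n * (α * Real.exp (-x)) * Real.exp (x / 2)) atTop (𝓝 0) := by
    have h1 := ((Real.tendsto_pow_mul_exp_neg_atTop_nhds_zero n).comp
      (tendsto_id.atTop_div_const two_pos)).const_mul (α * 2 ^ n)
    rw [mul_zero] at h1
    refine h1.congr fun x => ?_
    have e : Real.exp (-x) = Real.exp (-(x / 2)) * Real.exp (-(x / 2)) := by
      rw [← Real.exp_add]; ring_nf
    have e' : Real.exp (-(x / 2)) * Real.exp (x / 2) = 1 := by
      rw [← Real.exp_add]; simp
    simp only [Function.comp_apply, id_eq, div_pow]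
    rw [e]
    field_simp
    linear_combination -x ^ n * e'
  refine (h.trans_tendsto h0).congr fun x => ?_
  have e' : Real.exp (-x) * Real.exp x = 1 := by
    rw [← Real.exp_add]; simp
  rw [ratio]
  field_simp
  linear_combination -x ^ n * e'

theorem tendsto_ratio {α : ℝ} (hα₀ : 0 < α) (hα₂ : α < 2) (β : ℝ) :
    Tendsto (ratio α β) atTop (𝓝 1) := by
  simpa using (tendsto_pow_mul_ratio_sub_one hα₀ hα₂ β 0).add_const 1

theorem mittagLeffler_rpow_eq {α x : ℝ} (hα : 0 < α) (hx : 0 < x) (β : ℝ) :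
    mittagLeffler α β (x ^ α) = 1 / α * x ^ (1 - β) * Real.exp x * ratio α β x := by
  have e' : Real.exp x * Real.exp (-x) = 1 := by
    rw [← Real.exp_add]; simp
  have e : x ^ (1 - β) * x ^ (β - 1) = 1 := by
    rw [← Real.rpow_add hx]; simp
  rw [ratio]
  field_simp
  linear_combination -mittagLeffler α β (x ^ α) * (e + x ^ (1 - β) * x ^ (β - 1) * e')

theorem mittagLeffler_sub_div {α x : ℝ} (hα : 0 < α) (hx : 0 < x) (β : ℝ) (n : ℕ) :
    mittagLeffler α (β - n) (x ^ α) / mittagLeffler α β (x ^ α) =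
      x ^ n * (ratio α (β - n) x / ratio α β x) := by
  rw [mittagLeffler_rpow_eq hα hx, mittagLeffler_rpow_eq hα hx,
    show 1 - (β - n) = n + (1 - β) by ring, Real.rpow_add hx, Real.rpow_natCast]
  have := (Real.rpow_pos_of_pos hx (1 - β)).ne'
  have := (Real.exp_pos x).ne'
  rw [show 1 / α * (x ^ n * x ^ (1 - β)) * Real.exp x * ratio α (β - n) x =
    (1 / α * x ^ (1 - β) * Real.exp x) * (x ^ n * ratio α (β - n) x) by ring,
    mul_div_mul_left _ _ (by positivity), mul_div_assoc]

theorem eventually_mittagLeffler_rpow_pos {α : ℝ} (hα₀ : 0 < α) (hα₂ : α < 2) (β : ℝ) :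
    ∀ᶠ x in atTop, 0 < ratio α β x ∧ 0 < mittagLeffler α β (x ^ α) := by
  filter_upwards [eventually_gt_atTop 0, (tendsto_ratio hα₀ hα₂ β).eventually
    (lt_mem_nhds one_pos)] with x hx h
  refine ⟨h, ?_⟩
  rw [mittagLeffler_rpow_eq hα₀ hx]
  positivity

/-! ### Mean and variance in the variable x -/

theorem tendsto_mean_rpow {α : ℝ} (hα₀ : 0 < α) (hα₂ : α < 2) (β : ℝ) :
    Tendsto (fun x : ℝ => mean α β (x ^ α) - (1 - β + x) / α) atTop (𝓝 0) := by
  have h := (((tendsto_pow_mul_ratio_sub_one hα₀ hα₂ (β - 1) 1).sub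
    (tendsto_pow_mul_ratio_sub_one hα₀ hα₂ β 1)).div (tendsto_ratio hα₀ hα₂ β)
      one_ne_zero).div_const α
  simp only [sub_zero, zero_div] at h
  refine h.congr' ?_
  filter_upwards [eventually_gt_atTop 0, eventually_mittagLeffler_rpow_pos hα₀ hα₂ β]
    with x hx ⟨hr, hE⟩
  have h1 := mittagLeffler_sub_div hα₀ hx β 1
  rw [Nat.cast_one] at h1
  rw [mean_eq hα₀ hE.ne', h1]
  simp only [Pi.div_apply]
  field_simp
  ring

theorem tendsto_variance_rpow {α : ℝ} (hα₀ : 0 < α) (hα₂ : α < 2) (β : ℝ) :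
    Tendsto (fun x : ℝ => variance α β (x ^ α) - x / α ^ 2) atTop (𝓝 0) := by
  have hG := tendsto_ratio hα₀ hα₂ β
  have hG1 := tendsto_ratio hα₀ hα₂ (β - 1)
  have T := fun β n => tendsto_pow_mul_ratio_sub_one hα₀ hα₂ β n
  -- With r, r₁, r₂ the ratios at β, β - 1, β - 2, the x² coefficient is (r₂r - r₁²)/r², and r₂r -
  -- r₁² = (r₂ - 1)r + (r - 1) - (r₁ - 1)(r₁ + 1). The last summand is x(r₁/r - 1).
  have h := ((((((T (β - 2) 2).mul hG).add (T β 2)).sub ((T (β - 1) 2).mul (hG1.add_const 1))).div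
    (hG.pow 2) (by simp)).add (((T (β - 1) 1).sub (T β 1)).div hG one_ne_zero)).div_const (α ^ 2)
  norm_num at h
  refine h.congr' ?_
  filter_upwards [eventually_gt_atTop 0, eventually_mittagLeffler_rpow_pos hα₀ hα₂ β]
    with x hx ⟨hr, hE⟩
  have h1 := mittagLeffler_sub_div hα₀ hx β 1
  have h2 := mittagLeffler_sub_div hα₀ hx β 2
  rw [Nat.cast_one] at h1
  rw [Nat.cast_ofNat] at h2
  rw [variance_eq hα₀ hE.ne', h1, h2]
  field_simp
  ring

/-! ### Return to `lam` by x = λ^(1/α) -/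

theorem tendsto_rpow_one_div_atTop {α : ℝ} (hα : 0 < α) :
    Tendsto (fun lam : ℝ => lam ^ (1 / α)) atTop atTop :=
  tendsto_rpow_atTop (by positivity)

theorem eventually_rpow_one_div_rpow {α : ℝ} (hα : 0 < α) :
    ∀ᶠ lam : ℝ in atTop, (lam ^ (1 / α)) ^ α = lam := by
  filter_upwards [eventually_ge_atTop 0] with lam hlam
  rw [one_div, Real.rpow_inv_rpow hlam hα.ne']

theorem tendsto_mean {α : ℝ} (hα₀ : 0 < α) (hα₂ : α < 2) (β : ℝ) :
    Tendsto (fun lam : ℝ => mean α β lam - (1 - β + lam ^ (1 / α)) / α) atTop (𝓝 0) := by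
  refine ((tendsto_mean_rpow hα₀ hα₂ β).comp (tendsto_rpow_one_div_atTop hα₀)).congr' ?_
  filter_upwards [eventually_rpow_one_div_rpow hα₀] with lam h
  simp only [Function.comp_apply, h]

theorem tendsto_variance {α : ℝ} (hα₀ : 0 < α) (hα₂ : α < 2) (β : ℝ) :
    Tendsto (fun lam : ℝ => variance α β lam - lam ^ (1 / α) / α ^ 2) atTop (𝓝 0) := by
  refine ((tendsto_variance_rpow hα₀ hα₂ β).comp (tendsto_rpow_one_div_atTop hα₀)).congr' ?_
  filter_upwards [eventually_rpow_one_div_rpow hα₀] with lam h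
  simp only [Function.comp_apply, h]

theorem eventually_mittagLeffler_pos {α : ℝ} (hα₀ : 0 < α) (hα₂ : α < 2) (β : ℝ) :
    ∀ᶠ lam in atTop, 0 < mittagLeffler α β lam := by
  filter_upwards [eventually_rpow_one_div_rpow hα₀, (tendsto_rpow_one_div_atTop hα₀).eventually
    (eventually_mittagLeffler_rpow_pos hα₀ hα₂ β)] with lam h h1
  rw [← h]; exact h1.2

theorem mittagLeffler_isEquivalent {α : ℝ} (hα₀ : 0 < α) (hα₂ : α < 2) (β : ℝ) :
    (fun lam : ℝ => mittagLeffler α β lam) ~[atTop]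
      (fun lam : ℝ => 1 / α * lam ^ ((1 - β) / α) * Real.exp (lam ^ (1 / α))) := by
  refine isEquivalent_of_tendsto_one ?_
  refine ((tendsto_ratio hα₀ hα₂ β).comp (tendsto_rpow_one_div_atTop hα₀)).congr' ?_
  filter_upwards [eventually_rpow_one_div_rpow hα₀, eventually_gt_atTop 0] with lam h hlam
  have h1 := mittagLeffler_rpow_eq hα₀ (Real.rpow_pos_of_pos hlam (1 / α)) β
  rw [h, ← Real.rpow_mul hlam.le, show 1 / α * (1 - β) = (1 - β) / α by ring] at h1
  have := Real.rpow_pos_of_pos hlam ((1 - β) / α)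
  have := Real.exp_pos (lam ^ (1 / α))
  simp only [Pi.div_apply, Function.comp_apply]
  rw [h1, mul_div_cancel_left₀ _ (by positivity)]

end FracPoisson

theorem mainTheorem3 (α : ℝ) (hα₀ : 0 < α) (hα₂ : α < 2) (β : ℝ) :
    -- all series involved converge
    (∀ lam : ℝ, Summable fun k : ℕ => lam ^ k / Real.Gamma (β + α * k)) ∧
    (∀ (n : ℕ) (lam : ℝ), Summable fun k : ℕ => (k : ℝ) ^ n * FracPoisson.prob α β lam k) ∧
    -- the normalization is legitimate for all large `lam`
    (∀ᶠ lam : ℝ in atTop, 0 < FracPoisson.mittagLeffler α β lam ∧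
      HasSum (FracPoisson.prob α β lam) 1) ∧
    -- the asymptotic of the Mittag-Leffler function
    (fun lam : ℝ => FracPoisson.mittagLeffler α β lam) ~[atTop]
      (fun lam : ℝ => 1 / α * lam ^ ((1 - β) / α) * Real.exp (lam ^ (1 / α))) ∧
    -- the mean and the variance
    Tendsto (fun lam : ℝ => FracPoisson.mean α β lam - (1 - β + lam ^ (1 / α)) / α)
      atTop (𝓝 0) ∧
    Tendsto (fun lam : ℝ => FracPoisson.variance α β lam - lam ^ (1 / α) / α ^ 2)
      atTop (𝓝 0) ∧
    -- the effect of `β`: the mean is shifted, the variance is unchanged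
    Tendsto (fun lam : ℝ => FracPoisson.mean α β lam - FracPoisson.mean α 1 lam)
      atTop (𝓝 ((1 - β) / α)) ∧
    (∀ β' : ℝ, Tendsto
      (fun lam : ℝ => FracPoisson.variance α β lam - FracPoisson.variance α β' lam)
      atTop (𝓝 0)) := by
  refine ⟨FracPoisson.summable_term hα₀ β, fun n lam => ?_, ?_,
    FracPoisson.mittagLeffler_isEquivalent hα₀ hα₂ β, FracPoisson.tendsto_mean hα₀ hα₂ β,
    FracPoisson.tendsto_variance hα₀ hα₂ β, ?_, fun β' => ?_⟩
  · refine ((FracPoisson.summable_pow_mul_term hα₀ n β lam).mul_left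
      (1 / FracPoisson.mittagLeffler α β lam)).congr fun k => ?_
    rw [FracPoisson.prob]
    ring
  · filter_upwards [FracPoisson.eventually_mittagLeffler_pos hα₀ hα₂ β] with lam hE
    refine ⟨hE, ?_⟩
    have h := (FracPoisson.summable_term hα₀ β lam).hasSum.mul_left
      (1 / FracPoisson.mittagLeffler α β lam)
    rwa [← FracPoisson.mittagLeffler, one_div_mul_cancel hE.ne'] at h
  · have h := ((FracPoisson.tendsto_mean hα₀ hα₂ β).sub
      (FracPoisson.tendsto_mean hα₀ hα₂ 1)).add_const ((1 - β) / α)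
    rw [sub_zero, zero_add] at h
    refine h.congr fun lam => ?_
    ring
  · have h := (FracPoisson.tendsto_variance hα₀ hα₂ β).sub
      (FracPoisson.tendsto_variance hα₀ hα₂ β')
    rw [sub_zero] at h
    refine h.congr fun lam => ?_
    ring
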